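/- Let $G$ be a finite simple graph with $\mathrm{diam}(G)=2$ (so $G$ is connected). Edge-colorings may give adjacent edges the same color. An edge-coloring of $G$ is a monochromatic disconnection coloring if for any two distinct vertices $u,v$ there is a set $M$ of edges, all of the same color, such that $u$ and $v$ lie in different components of $G-M$; the monochromatic disconnection number $\mathrm{md}(G)$ is the maximum number of colors used by such a coloring. A block of $G$ is a maximal connected subgraph without cut-vertices of its own. Then: 1. If $G$ has a cut-vertex, then $\mathrm{md}(G)$ equals the number of blocks of $G$. 2. If $G$ is $2$-connected, then $\mathrm{md}(G)\le 2$. 3. If any two distinct nonadjacent vertices of $G$ have at least two common neighbors, then $\mathrm{md}(G)\le 2$, and $\mathrm{md}(G)=2$ if and only if $G$ is isomorphic to the Cartesian product $K_s\,\Box\, K_t$ for some integers $s,t\ge 2$. -/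

import Mathlib

namespace MonoDisc

variable {V : Type*}

/-- `M` is an edge-cut of `G` separating `u` and `v`: a set of edges of `G` such that `u` and `v`
lie in different components of `G - M`. -/
def IsCutSeparating (G : SimpleGraph V) (M : Set (Sym2 V)) (u v : V) : Prop :=
  M ⊆ G.edgeSet ∧ ¬ (G.deleteEdges M).Reachable u v

/-- All edges of `G` in `M` have the same color under the edge-coloring `Γ`
(adjacent edges may share a color). -/
def IsMonochromatic {G : SimpleGraph V} (Γ : G.edgeSet → ℕ) (M : Set (Sym2 V)) : Prop :=
  ∃ c : ℕ, ∀ e : G.edgeSet, (e : Sym2 V) ∈ M → Γ e = c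

/-- `Γ` is a monochromatic disconnection coloring: any two distinct vertices are separated by a
monochromatic edge-cut. -/
def IsMDColoring {G : SimpleGraph V} (Γ : G.edgeSet → ℕ) : Prop :=
  ∀ u v : V, u ≠ v → ∃ M : Set (Sym2 V), IsCutSeparating G M u v ∧ IsMonochromatic Γ M

/-- The monochromatic disconnection number: the maximum number of colors used by a monochromatic
disconnection coloring (see `isGreatest_md`: for a finite graph this maximum exists). -/
noncomputable def md (G : SimpleGraph V) : ℕ :=
  sSup {k : ℕ | ∃ Γ : G.edgeSet → ℕ, IsMDColoring Γ ∧ (Set.range Γ).ncard = k}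

theorem isGreatest_md [Finite V] (G : SimpleGraph V) :
    IsGreatest {k : ℕ | ∃ Γ : G.edgeSet → ℕ, IsMDColoring Γ ∧ (Set.range Γ).ncard = k} (md G) := by
  have hb : BddAbove {k : ℕ | ∃ Γ : G.edgeSet → ℕ, IsMDColoring Γ ∧ (Set.range Γ).ncard = k} := by
    refine ⟨Nat.card G.edgeSet, ?_⟩
    rintro k ⟨Γ, -, rfl⟩
    rw [← Set.image_univ, ← Set.ncard_univ]
    exact Set.ncard_image_le
  have hn : {k : ℕ | ∃ Γ : G.edgeSet → ℕ, IsMDColoring Γ ∧ (Set.range Γ).ncard = k}.Nonempty := by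
    refine ⟨_, fun _ => 0, fun u v huv => ⟨G.edgeSet, ⟨subset_rfl, ?_⟩, 0, fun _ _ => rfl⟩, rfl⟩
    have h : G.deleteEdges G.edgeSet = ⊥ := by
      ext a b
      simp
    rw [h]
    simpa using huv
  exact ⟨Nat.sSup_mem hn hb, fun k hk => le_csSup hb hk⟩

/-- `v` is a cut-vertex of `G`: deleting `v` disconnects two vertices of the same component. -/
def IsCutVertex (G : SimpleGraph V) (v : V) : Prop :=
  ∃ x y : ({v}ᶜ : Set V), G.Reachable (x : V) (y : V) ∧
    ¬ (G.induce ({v}ᶜ : Set V)).Reachable x y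

/-- Connected (in particular nonempty) and without cut-vertices. -/
def IsNonseparable (G : SimpleGraph V) : Prop :=
  G.Connected ∧ ∀ v : V, ¬ IsCutVertex G v

/-- A block of `G` is a maximal nonseparable subgraph. -/
def IsBlock (G : SimpleGraph V) (B : G.Subgraph) : Prop :=
  Maximal (fun H : G.Subgraph => IsNonseparable H.coe) B

/-- The number of blocks of a finite graph. -/
noncomputable def numBlocks (G : SimpleGraph V) : ℕ :=
  {B : G.Subgraph | IsBlock G B}.ncard

/-- `G` is `2`-connected: at least three vertices, connected, and no cut-vertex. -/
def IsTwoConnected (G : SimpleGraph V) : Prop :=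
  3 ≤ Nat.card V ∧ G.Connected ∧ ∀ v : V, ¬ IsCutVertex G v

end MonoDisc

namespace MonoDisc

variable {V : Type*} {G : SimpleGraph V}

/-! Label each vertex, for every color `c`, by its component in `G` minus the edges of color `c`.
The coloring condition says that labels determine vertices and that an edge changes exactly one
coordinate, its color (`exists_labelling`). Triangles are therefore monochromatic, and in diameter
two any two labels differ in at most two coordinates.

If three colors occur, this rigidity forces all edges onto axes through one vertex `x`; the axes
meet only in `x`, which is thus a cut-vertex (`exists_isCutVertex_of_three_colors`). This gives both
bounds by two.

A cut-vertex `x` is adjacent to every other vertex. Triangles through `x` allow one color per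
component of `G - x`, coloring by components attains this, and each block is `x` together with one
component.

With exactly two colors, a label is a pair of coordinates. Two common neighbors of vertices
differing in both must be the two opposite corners of the rectangle they span, so every pair occurs
and `G` is a product of complete graphs. Conversely, such a product is colored by direction. -/

theorem reachable_induction {P : V → Prop} {u v : V} (h : G.Reachable u v) (hu : P u)
    (step : ∀ a b, G.Adj a b → P a → P b) : P v := by
  obtain ⟨p⟩ := h
  induction p with
  | nil => exact hu
  | cons hab _ ih => exact ih (step _ _ hab hu)

/-- The edges of color `c`. -/
def colorClass (Γ : G.edgeSet → ℕ) (c : ℕ) : Set (Sym2 V) := {e | ∃ h : e ∈ G.edgeSet, Γ ⟨e, h⟩ = c}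

theorem IsMDColoring.exists_not_reachable {Γ : G.edgeSet → ℕ} (hΓ : IsMDColoring Γ) {u v : V}
    (huv : u ≠ v) : ∃ c, ¬ (G.deleteEdges (colorClass Γ c)).Reachable u v := by
  obtain ⟨M, ⟨hM, hr⟩, c, hc⟩ := hΓ u v huv
  refine ⟨c, fun h => hr (h.mono (SimpleGraph.deleteEdges_anti ?_))⟩
  exact fun e he => ⟨hM he, hc ⟨e, hM he⟩ he⟩

/-- A labelling of the vertices by functions on the colors: distinct vertices have distinct labels,
and the labels of the ends of an edge differ exactly at the color of the edge. -/
def IsHammingLabelling (Γ : G.edgeSet → ℕ) (f : V → ℕ → V) : Prop :=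
  Function.Injective f ∧
    ∀ u v (h : G.Adj u v) (c : ℕ), f u c ≠ f v c ↔ c = Γ ⟨s(u, v), h⟩

theorem IsMDColoring.exists_labelling {Γ : G.edgeSet → ℕ} (hΓ : IsMDColoring Γ) :
    ∃ f, IsHammingLabelling Γ f := by
  -- Representatives of components put the labels for all colors into the single type `V`.
  let f : V → ℕ → V := fun v c =>
    ((G.deleteEdges (colorClass Γ c)).connectedComponentMk v).out
  have hf : ∀ u v c, f u c = f v c ↔ (G.deleteEdges (colorClass Γ c)).Reachable u v := by
    intro u v c
    rw [← SimpleGraph.ConnectedComponent.eq]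
    exact (Function.LeftInverse.injective (g := Quot.mk _) Quot.out_eq).eq_iff
  have hne : ∀ u v (h : G.Adj u v) c, c ≠ Γ ⟨s(u, v), h⟩ → f u c = f v c := by
    intro u v h c hc
    rw [hf]
    refine SimpleGraph.Adj.reachable ?_
    rw [SimpleGraph.deleteEdges_adj]
    exact ⟨h, fun ⟨_, h'⟩ => hc h'.symm⟩
  have hinj : ∀ u v, u ≠ v → ∃ c, f u c ≠ f v c := by
    intro u v huv
    obtain ⟨c, hc⟩ := hΓ.exists_not_reachable huv
    exact ⟨c, fun h => hc ((hf _ _ _).1 h)⟩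
  refine ⟨f, ?_, ?_⟩
  · intro u v huv
    by_contra h
    obtain ⟨c, hc⟩ := hinj u v h
    exact hc (congrFun huv c)
  · intro u v h c
    constructor
    · intro h1
      by_contra h2
      exact h1 (hne u v h c h2)
    · rintro rfl
      obtain ⟨c, hc⟩ := hinj u v h.ne
      by_cases h2 : c = Γ ⟨s(u, v), h⟩
      · rwa [← h2]
      · exact absurd (hne u v h c h2) hc

/-! ### Diameter two and the rigidity of labellings -/

/-- Any two vertices are equal, adjacent, or have a common neighbor. -/
def HasDistLeTwo (G : SimpleGraph V) : Prop :=
  ∀ u v, u = v ∨ G.Adj u v ∨ ∃ w, G.Adj u w ∧ G.Adj w v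

/-- An infinite extended diameter gives `diam` the value `0`, so a nonzero value implies
connectedness. -/
theorem connected_of_diam_eq_two (h : G.diam = 2) : G.Connected := by
  have h0 : G.diam ≠ 0 := by omega
  have : Nonempty V := (SimpleGraph.nontrivial_of_diam_ne_zero h0).to_nonempty
  exact SimpleGraph.connected_of_ediam_ne_top (SimpleGraph.ediam_ne_top_of_diam_ne_zero h0)

theorem hasDistLeTwo_of_diam_eq_two (h : G.diam = 2) : HasDistLeTwo G := by
  have hc := connected_of_diam_eq_two h
  intro u v
  have h0 : G.diam ≠ 0 := by omega
  have hd := SimpleGraph.dist_le_diam (SimpleGraph.ediam_ne_top_of_diam_ne_zero h0) (u := u) (v := v)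
  obtain ⟨p, hp⟩ := hc.exists_walk_length_eq_dist u v
  rw [← hp, h] at hd
  match p, hd with
  | .nil, _ => exact Or.inl rfl
  | .cons h1 .nil, _ => exact Or.inr (Or.inl h1)
  | .cons h1 (.cons h2 .nil), _ => exact Or.inr (Or.inr ⟨_, h1, h2⟩)
  | .cons _ (.cons _ (.cons _ _)), h3 => simp at h3

theorem HasDistLeTwo.preconnected (h : HasDistLeTwo G) : G.Preconnected := by
  intro u v
  rcases h u v with rfl | h | ⟨w, h1, h2⟩
  · rfl
  · exact h.reachable
  · exact h1.reachable.trans h2.reachable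

namespace IsHammingLabelling

variable {Γ : G.edgeSet → ℕ} {f : V → ℕ → V}

theorem eq_of_ne_color (hf : IsHammingLabelling Γ f) {u v : V} (h : G.Adj u v) {c : ℕ}
    (hc : c ≠ Γ ⟨s(u, v), h⟩) : f u c = f v c :=
  not_not.1 fun h' => hc ((hf.2 u v h c).1 h')

theorem ne_color (hf : IsHammingLabelling Γ f) {u v : V} (h : G.Adj u v) :
    f u (Γ ⟨s(u, v), h⟩) ≠ f v (Γ ⟨s(u, v), h⟩) := (hf.2 u v h _).2 rfl

theorem color_eq_of_triangle (hf : IsHammingLabelling Γ f) {u v w : V} (huv : G.Adj u v)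
    (huw : G.Adj u w) (hvw : G.Adj v w) :
    Γ ⟨s(u, v), huv⟩ = Γ ⟨s(u, w), huw⟩ ∧ Γ ⟨s(v, w), hvw⟩ = Γ ⟨s(u, v), huv⟩ := by
  have h1 := hf.2 u v huv
  have h2 := hf.2 u w huw
  have h3 := hf.2 v w hvw
  generalize Γ ⟨s(u, v), huv⟩ = a at *
  generalize Γ ⟨s(u, w), huw⟩ = b at *
  generalize Γ ⟨s(v, w), hvw⟩ = c at *
  have := h1 a
  have := h1 b
  have := h1 c
  have := h2 a
  have := h2 b
  have := h3 a
  have := h3 b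
  have := h3 c
  grind

theorem false_of_three_ne (hf : IsHammingLabelling Γ f) (hG : HasDistLeTwo G) {u v : V}
    {a b c : ℕ} (hab : a ≠ b) (hac : a ≠ c) (hbc : b ≠ c) (ha : f u a ≠ f v a)
    (hb : f u b ≠ f v b) (hc : f u c ≠ f v c) : False := by
  rcases hG u v with rfl | h | ⟨w, h1, h2⟩
  · exact ha rfl
  · have := hf.2 u v h
    grind
  · have := hf.2 u w h1
    have := hf.2 w v h2
    grind

/-- If two colors meet at `x`, the edges of any third color lie on the axis through `x`. -/
theorem eq_of_third_color (hf : IsHammingLabelling Γ f) (hG : HasDistLeTwo G) {x y z p q : V}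
    (hxy : G.Adj x y) (hxz : G.Adj x z) (hpq : G.Adj p q)
    (hab : Γ ⟨s(x, y), hxy⟩ ≠ Γ ⟨s(x, z), hxz⟩)
    (hca : Γ ⟨s(p, q), hpq⟩ ≠ Γ ⟨s(x, y), hxy⟩) (hcb : Γ ⟨s(p, q), hpq⟩ ≠ Γ ⟨s(x, z), hxz⟩)
    {d : ℕ} (hd : d ≠ Γ ⟨s(p, q), hpq⟩) : f p d = f x d ∧ f q d = f x d := by
  have h1 := hf.2 x y hxy
  have h2 := hf.2 x z hxz
  have h3 := hf.2 p q hpq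
  generalize Γ ⟨s(x, y), hxy⟩ = a at *
  generalize Γ ⟨s(x, z), hxz⟩ = b at *
  generalize Γ ⟨s(p, q), hpq⟩ = c at *
  have key : ∀ r, f r c ≠ f x c → f r d = f x d := by
    intro r hr
    by_contra hrd
    -- Suppose `r` differs from `x` at `c` and `d`. Moving from `x` to `y'` changes only `a'`, so
    -- `r` differs from `x` or from `y'` at all of `c`, `d`, `a'`.
    have aux : ∀ y' a', (∀ c, f x c ≠ f y' c ↔ c = a') → c ≠ a' → d ≠ a' → False := by
      intro y' a' h hca' hda'
      by_cases hra : f r a' = f x a'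
      · exact hf.false_of_three_ne hG (u := r) (v := y') hd hda' hca' (by grind) (by grind) (by grind)
      · exact hf.false_of_three_ne hG (u := r) (v := x) hd hda' hca' hrd hr hra
    by_cases hda : d = a
    · exact aux z b h2 hcb (hda ▸ hab)
    · exact aux y a h1 hca hda
  have hpqd : f p d = f q d := by grind
  by_cases hp : f p c = f x c
  · have := key q (by grind)
    grind
  · have := key p hp
    grind

theorem adj_of_third_color (hf : IsHammingLabelling Γ f) (hG : HasDistLeTwo G) {x y z p q : V}
    (hxy : G.Adj x y) (hxz : G.Adj x z) (hpq : G.Adj p q)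
    (hab : Γ ⟨s(x, y), hxy⟩ ≠ Γ ⟨s(x, z), hxz⟩)
    (hca : Γ ⟨s(p, q), hpq⟩ ≠ Γ ⟨s(x, y), hxy⟩) (hcb : Γ ⟨s(p, q), hpq⟩ ≠ Γ ⟨s(x, z), hxz⟩)
    (hq : q ≠ x) : ∃ h : G.Adj x q, Γ ⟨s(x, q), h⟩ = Γ ⟨s(p, q), hpq⟩ := by
  have hax := fun d (hd : d ≠ Γ ⟨s(p, q), hpq⟩) =>
    (hf.eq_of_third_color hG hxy hxz hpq hab hca hcb hd).2
  have hqc : f q (Γ ⟨s(p, q), hpq⟩) ≠ f x (Γ ⟨s(p, q), hpq⟩) := by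
    intro h
    refine hq (hf.1 (funext fun d => ?_))
    by_cases hd : d = Γ ⟨s(p, q), hpq⟩
    · rw [hd, h]
    · exact hax d hd
  have h1 := hf.2 x y hxy
  have h2 := hf.2 x z hxz
  suffices h : G.Adj x q from ⟨h, ((hf.2 x q h _).1 hqc.symm).symm⟩
  -- The labels of `q` and `z` differ at two colors, that of `pq` and that of `xz`. A path `q w z`
  -- must change the color of `pq` first, since an edge of that color lies on the axis of `x` and
  -- `z` does not; then `w` has the label of `x`.
  rcases hG q z with rfl | h | ⟨w, hqw, hwz⟩
  · exact hxz
  · have h3 := hf.2 q z h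
    have h4 := hf.ne_color hxz
    have h5 := hax _ hcb.symm
    have h6 := hf.eq_of_ne_color hxz hcb
    have h7 := (h3 _).1 (h5.trans_ne h4)
    have h8 := (h3 _).1 (h6 ▸ hqc)
    exact absurd (h8.trans h7.symm) hcb
  · by_cases hc : Γ ⟨s(w, z), hwz⟩ = Γ ⟨s(p, q), hpq⟩
    · have h5 := (hf.eq_of_third_color hG hxy hxz hwz hab (hc ▸ hca) (hc ▸ hcb)
        (d := Γ ⟨s(x, z), hxz⟩) (hc ▸ hcb.symm)).2
      exact absurd h5.symm (hf.ne_color hxz)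
    · have h3 := hf.2 q w hqw
      have h4 := hf.2 w z hwz
      have : w = x := by
        refine hf.1 (funext fun d => ?_)
        have := hax d
        grind
      subst this
      exact hqw.symm

/-- Otherwise a color present at a vertex is the only one there, and by connectedness it spreads to
the whole graph. -/
theorem exists_two_colors_at (hG : G.Preconnected) {e e' : G.edgeSet} (h : Γ e ≠ Γ e') :
    ∃ x y z, ∃ (hxy : G.Adj x y) (hxz : G.Adj x z),
      Γ ⟨s(x, y), hxy⟩ = Γ e ∧ Γ ⟨s(x, z), hxz⟩ ≠ Γ e := by
  by_contra! hcon
  obtain ⟨⟨u, v⟩, huv⟩ := e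
  obtain ⟨⟨p, q⟩, hpq⟩ := e'
  have hp : ∃ (w : V) (h : G.Adj p w), Γ ⟨s(p, w), h⟩ = Γ ⟨s(u, v), huv⟩ := by
    refine reachable_induction (hG u p)
      (P := fun a => ∃ (w : V) (h : G.Adj a w), Γ ⟨s(a, w), h⟩ = Γ ⟨s(u, v), huv⟩) ⟨v, huv, rfl⟩ ?_
    rintro a b hab ⟨w, haw, hw⟩
    have := hcon a w b haw hab hw
    refine ⟨a, hab.symm, ?_⟩
    rw [← this]
    congr 2
    exact Sym2.eq_swap
  obtain ⟨w, hpw, hw⟩ := hp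
  exact h (hcon p w q hpw hpq hw).symm

end IsHammingLabelling

/-! ### Three colors force a cut-vertex -/

theorem exists_isCutVertex_of_three_colors [Finite V] (hG : HasDistLeTwo G) {Γ : G.edgeSet → ℕ}
    (hΓ : IsMDColoring Γ) (h3 : 2 < (Set.range Γ).ncard) : ∃ v, IsCutVertex G v := by
  obtain ⟨f, hf⟩ := hΓ.exists_labelling
  obtain ⟨_, _, _, ⟨e₁, rfl⟩, ⟨e₂, rfl⟩, _, h12, -, -⟩ := (Set.two_lt_ncard_iff (Set.toFinite _)).1 h3
  obtain ⟨x, y, z, hxy, hxz, h1, h2⟩ :=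
    IsHammingLabelling.exists_two_colors_at (Γ := Γ) hG.preconnected h12
  rw [← h1] at h2
  have hab := h2.symm
  obtain ⟨e₃, hca, hcb⟩ : ∃ e, Γ e ≠ Γ ⟨s(x, y), hxy⟩ ∧ Γ e ≠ Γ ⟨s(x, z), hxz⟩ := by
    by_contra! hcon
    have hsub : Set.range Γ ⊆ {Γ ⟨s(x, y), hxy⟩, Γ ⟨s(x, z), hxz⟩} := by
      rintro _ ⟨e, rfl⟩
      by_cases he : Γ e = Γ ⟨s(x, y), hxy⟩
      · exact Or.inl he
      · exact Or.inr (hcon e he)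
    have := (Set.ncard_le_ncard hsub).trans (Set.ncard_insert_le _ _)
    simp at this
    omega
  obtain ⟨t, hxt, hta, htb⟩ : ∃ t, ∃ h : G.Adj x t,
      Γ ⟨s(x, t), h⟩ ≠ Γ ⟨s(x, y), hxy⟩ ∧ Γ ⟨s(x, t), h⟩ ≠ Γ ⟨s(x, z), hxz⟩ := by
    obtain ⟨⟨p, q⟩, hpq⟩ := e₃
    by_cases hq : q = x
    · subst hq
      have hsw : Γ ⟨s(p, q), hpq⟩ = Γ ⟨s(q, p), SimpleGraph.Adj.symm hpq⟩ := by
        congr 2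
        exact Sym2.eq_swap
      exact ⟨p, SimpleGraph.Adj.symm hpq, hsw ▸ hca, hsw ▸ hcb⟩
    · obtain ⟨h, he⟩ := hf.adj_of_third_color hG hxy hxz hpq hab hca hcb hq
      exact ⟨q, h, he ▸ hca, he ▸ hcb⟩
  -- Among the three colors at `x`, two differ from the color of `pq`, so `eq_of_third_color`
  -- applies to every edge.
  have haxis : ∀ p q (hpq : G.Adj p q) d, d ≠ Γ ⟨s(p, q), hpq⟩ → f p d = f x d ∧ f q d = f x d := by
    intro p q hpq d hd
    by_cases ha : Γ ⟨s(p, q), hpq⟩ = Γ ⟨s(x, y), hxy⟩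
    · exact hf.eq_of_third_color hG hxz hxt hpq htb.symm (ha ▸ hab) (ha ▸ hta.symm) hd
    · by_cases hb : Γ ⟨s(p, q), hpq⟩ = Γ ⟨s(x, z), hxz⟩
      · exact hf.eq_of_third_color hG hxy hxt hpq hta.symm ha (hb ▸ htb.symm) hd
      · exact hf.eq_of_third_color hG hxy hxz hpq hab ha hb hd
  refine ⟨x, ⟨y, hxy.ne'⟩, ⟨z, hxz.ne'⟩, hG.preconnected _ _, fun hr => ?_⟩
  -- Off `x`, a walk cannot leave the axis of the color of `xy`: returning to the label of `x` at
  -- that color would mean being `x`.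
  have hz : f z (Γ ⟨s(x, y), hxy⟩) ≠ f x (Γ ⟨s(x, y), hxy⟩) := by
    refine reachable_induction (G := G.induce {x}ᶜ) (u := ⟨y, hxy.ne'⟩) (v := ⟨z, hxz.ne'⟩) hr
      (P := fun w => f w (Γ ⟨s(x, y), hxy⟩) ≠ f x (Γ ⟨s(x, y), hxy⟩)) (hf.ne_color hxy).symm ?_
    rintro ⟨v, hv⟩ ⟨w, hw⟩ hvw hva hwa
    have hvw : G.Adj v w := hvw
    have hcol : Γ ⟨s(x, y), hxy⟩ = Γ ⟨s(v, w), hvw⟩ := by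
      by_contra hne
      exact hva (haxis v w hvw _ hne).1
    refine hw (hf.1 (funext fun d => ?_))
    by_cases hd : d = Γ ⟨s(x, y), hxy⟩
    · rw [hd]; exact hwa
    · exact (haxis v w hvw d (hcol ▸ hd)).2
  exact hz (hf.eq_of_ne_color hxz hab).symm

theorem md_le_two_of_no_cutVertex [Finite V] (hG : HasDistLeTwo G)
    (h : ∀ v, ¬ IsCutVertex G v) : md G ≤ 2 := by
  by_contra! hlt
  obtain ⟨Γ, hΓ, hk⟩ := (isGreatest_md G).1
  obtain ⟨v, hv⟩ := exists_isCutVertex_of_three_colors hG hΓ (hk ▸ hlt)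
  exact h v hv

/-! ### Graphs with a cut-vertex: colors and components -/

/-- A vertex `v` and any vertex in another component of `G - x` can have only `x` as a common
neighbor. -/
theorem IsCutVertex.adj_all {x : V} (hx : IsCutVertex G x) (hG : HasDistLeTwo G) :
    ∀ v, v ≠ x → G.Adj x v := by
  obtain ⟨y, z, -, hyz⟩ := hx
  intro v hv
  obtain ⟨w, hw⟩ : ∃ w, ¬ (G.induce ({x}ᶜ : Set V)).Reachable ⟨v, hv⟩ w := by
    by_contra! hcon
    exact hyz ((hcon y).symm.trans (hcon z))
  rcases hG v w with h | h | ⟨t, h1, h2⟩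
  · have h' : (⟨v, hv⟩ : ({x}ᶜ : Set V)) = w := Subtype.ext h
    exact absurd (h' ▸ SimpleGraph.Reachable.refl _) hw
  · exact absurd (SimpleGraph.Adj.reachable (by simpa using h)) hw
  · by_cases ht : t = x
    · exact ht ▸ h1.symm
    · refine absurd (SimpleGraph.Reachable.trans (v := ⟨t, ht⟩) ?_ ?_) hw
      · exact SimpleGraph.Adj.reachable (by simpa using h1)
      · exact SimpleGraph.Adj.reachable (by simpa using h2)

/-- The component of `G - x` containing `v`. -/
def compOf (G : SimpleGraph V) (x v : V) (hv : v ≠ x) :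
    (G.induce ({x}ᶜ : Set V)).ConnectedComponent :=
  (G.induce ({x}ᶜ : Set V)).connectedComponentMk ⟨v, hv⟩

theorem compOf_eq_of_adj {x u v : V} (hu : u ≠ x) (hv : v ≠ x) (h : G.Adj u v) :
    compOf G x u hu = compOf G x v hv :=
  SimpleGraph.ConnectedComponent.sound (SimpleGraph.Adj.reachable (by simpa using h))

theorem exists_compOf {x : V} (D : (G.induce ({x}ᶜ : Set V)).ConnectedComponent) :
    ∃ v hv, compOf G x v hv = D := by
  induction D using SimpleGraph.ConnectedComponent.ind with
  | h v => exact ⟨v.1, v.2, rfl⟩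

theorem exists_ne_mem_edge {x : V} (e : G.edgeSet) : ∃ w, w ≠ x ∧ w ∈ e.1 := by
  obtain ⟨⟨u, v⟩, huv⟩ := e
  by_cases hu : u = x
  · exact ⟨v, fun hv => SimpleGraph.Adj.ne huv (hu.trans hv.symm), Sym2.mem_mk_right _ _⟩
  · exact ⟨u, hu, Sym2.mem_mk_left _ _⟩

theorem exists_mdColoring_of_adj_all [Finite V] {x : V} (hx : ∀ v, v ≠ x → G.Adj x v) :
    ∃ Γ : G.edgeSet → ℕ, IsMDColoring Γ ∧
      (Set.range Γ).ncard = Nat.card (G.induce ({x}ᶜ : Set V)).ConnectedComponent := by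
  obtain ⟨n, ⟨g⟩⟩ := Finite.exists_equiv_fin (G.induce ({x}ᶜ : Set V)).ConnectedComponent
  choose w hwx hwe using fun e : G.edgeSet => exists_ne_mem_edge (x := x) e
  have hcomp : ∀ (e : G.edgeSet) v (hv : v ≠ x), v ∈ e.1 →
      compOf G x (w e) (hwx e) = compOf G x v hv := by
    intro e v hv hve
    by_cases h : w e = v
    · simp only [h]
    · have : e.1 = s(w e, v) := (Sym2.mem_and_mem_iff h).1 ⟨hwe e, hve⟩
      exact compOf_eq_of_adj _ _ (by simpa [this] using e.2)
  refine ⟨fun e => g (compOf G x (w e) (hwx e)), ?_, ?_⟩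
  · have key : ∀ u v, u ≠ x → u ≠ v → ∃ M : Set (Sym2 V), IsCutSeparating G M u v ∧
        IsMonochromatic (fun e : G.edgeSet => (g (compOf G x (w e) (hwx e)) : ℕ)) M := by
      intro u v hu huv
      -- All edges at `u ≠ x` get the color of the component of `u`, and removing them isolates `u`.
      refine ⟨G.incidenceSet u, ⟨G.incidenceSet_subset u, fun hr => ?_⟩,
        g (compOf G x u hu), fun e he => ?_⟩
      · refine huv (reachable_induction (P := fun a => u = a) hr rfl ?_)
        rintro a b hab rfl
        rw [SimpleGraph.deleteEdges_adj] at hab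
        exact absurd ⟨hab.1, Sym2.mem_mk_left _ _⟩ hab.2
      · simp only [hcomp e u hu he.2]
    intro u v huv
    by_cases hu : u = x
    · obtain ⟨M, ⟨h1, h2⟩, h3⟩ := key v u (fun hv => huv (hu.trans hv.symm)) huv.symm
      exact ⟨M, ⟨h1, fun h => h2 h.symm⟩, h3⟩
    · exact key u v hu huv
  · have hr : Set.range (fun e => (g (compOf G x (w e) (hwx e)) : ℕ)) =
        Set.range (fun D => (g D : ℕ)) := by
      ext c
      constructor
      · rintro ⟨e, rfl⟩
        exact ⟨_, rfl⟩
      · rintro ⟨D, rfl⟩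
        obtain ⟨v, hv, rfl⟩ := exists_compOf D
        exact ⟨⟨s(x, v), hx v hv⟩, by
          simp only [hcomp ⟨s(x, v), hx v hv⟩ v hv (Sym2.mem_mk_right _ _)]⟩
    have hinj : Function.Injective fun D => (g D : ℕ) := Fin.val_injective.comp g.injective
    rw [hr, ← Set.image_univ, Set.ncard_image_of_injective _ hinj, Set.ncard_univ]

/-- An edge `ab` off `x` closes a monochromatic triangle with `x`, so a component and its edges to
`x` carry a single color. -/
theorem ncard_range_le_of_adj_all [Finite V] {x : V} (hx : ∀ v, v ≠ x → G.Adj x v)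
    {Γ : G.edgeSet → ℕ} (hΓ : IsMDColoring Γ) :
    (Set.range Γ).ncard ≤ Nat.card (G.induce ({x}ᶜ : Set V)).ConnectedComponent := by
  obtain ⟨f, hf⟩ := hΓ.exists_labelling
  have hcol : ∀ v w (hv : v ≠ x) (hw : w ≠ x), compOf G x v hv = compOf G x w hw →
      Γ ⟨s(x, v), hx v hv⟩ = Γ ⟨s(x, w), hx w hw⟩ := by
    intro v w hv hw h
    refine reachable_induction
      (P := fun a : ({x}ᶜ : Set V) => Γ ⟨s(x, v), hx v hv⟩ = Γ ⟨s(x, a), hx a a.2⟩)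
      (SimpleGraph.ConnectedComponent.exact h) rfl ?_
    rintro a b hab h'
    exact h'.trans (hf.color_eq_of_triangle (hx a a.2) (hx b b.2) hab).1
  choose r hr hrD using exists_compOf (G := G) (x := x)
  have hsub : Set.range Γ ⊆ Set.range fun D => Γ ⟨s(x, r D), hx _ (hr D)⟩ := by
    rintro _ ⟨⟨⟨u, v⟩, huv⟩, rfl⟩
    have huv : G.Adj u v := huv
    have hax : ∀ v (hv : v ≠ x), Γ ⟨s(x, v), hx v hv⟩ ∈
        Set.range fun D => Γ ⟨s(x, r D), hx _ (hr D)⟩ :=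
      fun v hv => ⟨compOf G x v hv, hcol _ _ _ _ (hrD _)⟩
    by_cases hu : u = x
    · subst hu
      exact hax v huv.ne'
    · by_cases hv : v = x
      · subst hv
        convert hax u hu using 3
        exact Subtype.ext Sym2.eq_swap
      · have h := (hf.color_eq_of_triangle (hx u hu) (hx v hv) huv).2
        rw [← show _ = Γ ⟨Quot.mk _ (u, v), huv⟩ from h.symm]
        exact hax u hu
  refine (Set.ncard_le_ncard hsub (Set.toFinite _)).trans ?_
  rw [← Set.image_univ, ← Set.ncard_univ]
  exact Set.ncard_image_le

theorem md_eq_card_components [Finite V] {x : V} (hx : ∀ v, v ≠ x → G.Adj x v) :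
    md G = Nat.card (G.induce ({x}ᶜ : Set V)).ConnectedComponent := by
  refine (isGreatest_md G).unique ⟨exists_mdColoring_of_adj_all hx, ?_⟩
  rintro k ⟨Γ, hΓ, rfl⟩
  exact ncard_range_le_of_adj_all hx hΓ

/-! ### Blocks and components of `G - x` -/

/-- The subgraph of `G` induced by `x` and a component of `G - x`. -/
def blockOf {x : V} (D : (G.induce ({x}ᶜ : Set V)).ConnectedComponent) : G.Subgraph :=
  (⊤ : G.Subgraph).induce {v | ∀ hv : v ≠ x, compOf G x v hv = D}

theorem blockOf_adj {x : V} (D : (G.induce ({x}ᶜ : Set V)).ConnectedComponent) {u v : V} :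
    (blockOf D).Adj u v ↔ u ∈ (blockOf D).verts ∧ v ∈ (blockOf D).verts ∧ G.Adj u v := by
  simp [blockOf]

/-- Deleting `x` leaves the connected component `D`; deleting any other vertex leaves `x` adjacent
to all that remains. -/
theorem isNonseparable_blockOf {x : V} (hx : ∀ v, v ≠ x → G.Adj x v)
    (D : (G.induce ({x}ᶜ : Set V)).ConnectedComponent) : IsNonseparable (blockOf D).coe := by
  have hxD : x ∈ (blockOf D).verts := fun h => absurd rfl h
  have hadj : ∀ v : (blockOf D).verts, v ≠ ⟨x, hxD⟩ → (blockOf D).coe.Adj ⟨x, hxD⟩ v := by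
    intro v hv
    rw [SimpleGraph.Subgraph.coe_adj, blockOf_adj]
    exact ⟨hxD, v.2, hx _ fun h => hv (Subtype.ext h)⟩
  have hreach : ∀ v : (blockOf D).verts, (blockOf D).coe.Reachable ⟨x, hxD⟩ v := by
    intro v
    by_cases hv : v = ⟨x, hxD⟩
    · rw [hv]
    · exact (hadj v hv).reachable
  have : Nonempty (blockOf D).verts := ⟨⟨x, hxD⟩⟩
  refine ⟨⟨fun u v => (hreach u).symm.trans (hreach v)⟩, ?_⟩
  rintro v ⟨y, z, -, hyz⟩
  by_cases hv : v = ⟨x, hxD⟩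
  · subst hv
    have hy : (y : (blockOf D).verts).1 ≠ x := fun h => y.2 (Subtype.ext h)
    have hz : (z : (blockOf D).verts).1 ≠ x := fun h => z.2 (Subtype.ext h)
    have hr := SimpleGraph.ConnectedComponent.exact
      ((y.1.2 hy : compOf G x _ hy = D).trans (z.1.2 hz : compOf G x _ hz = D).symm)
    have := reachable_induction (P := fun a : ({x}ᶜ : Set V) =>
      ∃ h : a.1 ∈ (blockOf D).verts, ((blockOf D).coe.induce {⟨x, hxD⟩}ᶜ).Reachable y
        ⟨⟨a, h⟩, fun h' => a.2 (Subtype.mk.inj h')⟩) hr ⟨y.1.2, by rfl⟩ ?_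
    · obtain ⟨_, h⟩ := this
      exact hyz h
    · rintro a b hab ⟨ha, h⟩
      have hab' : G.Adj a b := hab
      have hb : b.1 ∈ (blockOf D).verts :=
        fun hb => (compOf_eq_of_adj a.2 hb hab').symm.trans (ha a.2)
      refine ⟨hb, h.trans (SimpleGraph.Adj.reachable ?_)⟩
      change (blockOf D).Adj a b
      rw [blockOf_adj]
      exact ⟨ha, hb, hab'⟩
  · have hvx : (⟨x, hxD⟩ : (blockOf D).verts) ∈ ({v}ᶜ : Set (blockOf D).verts) :=
      fun h => hv (Eq.symm h)
    have hr : ∀ y : ({v}ᶜ : Set (blockOf D).verts),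
        ((blockOf D).coe.induce {v}ᶜ).Reachable ⟨_, hvx⟩ y := by
      intro y
      by_cases hy : y = ⟨_, hvx⟩
      · rw [hy]
      · exact SimpleGraph.Adj.reachable (hadj y.1 fun h => hy (Subtype.ext h))
    exact hyz ((hr y).symm.trans (hr z))

theorem le_blockOf {x : V} (D : (G.induce ({x}ᶜ : Set V)).ConnectedComponent) {H : G.Subgraph}
    (h : H.verts ⊆ (blockOf D).verts) : H ≤ blockOf D := by
  refine ⟨h, fun u v huv => ?_⟩
  rw [blockOf_adj]
  exact ⟨h huv.fst_mem, h huv.snd_mem, huv.adj_sub⟩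

/-- Without `x`, a nonseparable subgraph stays connected and so meets only one component. If it has
no vertex but `x`, any component will do. -/
theorem exists_le_blockOf {x : V} [hne : Nonempty (G.induce ({x}ᶜ : Set V)).ConnectedComponent]
    {H : G.Subgraph} (hH : IsNonseparable H.coe) :
    ∃ D : (G.induce ({x}ᶜ : Set V)).ConnectedComponent, H ≤ blockOf D := by
  by_cases hy : ∃ y ∈ H.verts, y ≠ x
  · obtain ⟨y, hyH, hyx⟩ := hy
    refine ⟨compOf G x y hyx, le_blockOf _ fun z hzH hzx => ?_⟩
    have hconn := hH.1.preconnected ⟨y, hyH⟩ ⟨z, hzH⟩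
    by_cases hxH : x ∈ H.verts
    · have hr : (H.coe.induce {⟨x, hxH⟩}ᶜ).Reachable
          ⟨⟨y, hyH⟩, fun h => hyx (congrArg Subtype.val h)⟩
          ⟨⟨z, hzH⟩, fun h => hzx (congrArg Subtype.val h)⟩ := by
        by_contra hcon
        exact hH.2 ⟨x, hxH⟩ ⟨_, _, hconn, hcon⟩
      have := reachable_induction (P := fun a : ({⟨x, hxH⟩}ᶜ : Set H.verts) =>
        ∀ h : a.1.1 ≠ x, compOf G x a.1.1 h = compOf G x y hyx) hr (fun _ => rfl) ?_
      · exact this hzx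
      · rintro a b hab h hb
        have ha : a.1.1 ≠ x := fun h' => a.2 (Subtype.ext h')
        have hab : H.Adj a.1.1 b.1.1 := hab
        exact (compOf_eq_of_adj ha hb hab.adj_sub).symm.trans (h ha)
    · have := reachable_induction (P := fun a : H.verts =>
        ∀ h : a.1 ≠ x, compOf G x a.1 h = compOf G x y hyx) hconn (fun _ => rfl) ?_
      · exact this hzx
      · rintro a b hab h hb
        have ha : a.1 ≠ x := fun h' => hxH (h' ▸ a.2)
        have hab : H.Adj a.1 b.1 := hab
        exact (compOf_eq_of_adj ha hb hab.adj_sub).symm.trans (h ha)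
  · push Not at hy
    obtain ⟨D⟩ := hne
    exact ⟨D, le_blockOf _ fun z hz hzx => absurd (hy z hz) hzx⟩

theorem eq_of_blockOf_le {x : V} {D E : (G.induce ({x}ᶜ : Set V)).ConnectedComponent}
    (h : blockOf D ≤ blockOf E) : D = E := by
  obtain ⟨v, hv, rfl⟩ := exists_compOf D
  exact h.1 (fun _ => rfl) hv

theorem numBlocks_eq_card_components {x : V} (hx : ∀ v, v ≠ x → G.Adj x v)
    [Nonempty (G.induce ({x}ᶜ : Set V)).ConnectedComponent] :
    numBlocks G = Nat.card (G.induce ({x}ᶜ : Set V)).ConnectedComponent := by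
  have : {B : G.Subgraph | IsBlock G B} = Set.range (blockOf (G := G) (x := x)) := by
    ext B
    constructor
    · intro hB
      obtain ⟨D, hD⟩ := exists_le_blockOf (x := x) hB.1
      exact ⟨D, (hB.2 (isNonseparable_blockOf hx D) hD).antisymm hD⟩
    · rintro ⟨D, rfl⟩
      refine ⟨isNonseparable_blockOf hx D, fun H hH hle => ?_⟩
      obtain ⟨E, hE⟩ := exists_le_blockOf (x := x) hH
      rwa [eq_of_blockOf_le (hle.trans hE)]
  rw [numBlocks, this, ← Set.image_univ, Set.ncard_image_of_injective _
    (fun D E h => eq_of_blockOf_le h.le), Set.ncard_univ]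

theorem md_eq_numBlocks [Finite V] (hG : HasDistLeTwo G) {x : V} (hx : IsCutVertex G x) :
    md G = numBlocks G := by
  have hadj := hx.adj_all hG
  obtain ⟨y, -⟩ := hx
  have : Nonempty (G.induce ({x}ᶜ : Set V)).ConnectedComponent := ⟨compOf G x y y.2⟩
  rw [md_eq_card_components hadj, numBlocks_eq_card_components hadj]

/-! ### Two common neighbors and products of complete graphs -/

theorem not_isCutVertex_of_two_commonNeighbors
    (h2 : ∀ u v : V, u ≠ v → ¬ G.Adj u v → 2 ≤ (G.commonNeighbors u v).ncard) (x : V) :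
    ¬ IsCutVertex G x := by
  rintro ⟨y, z, -, hyz⟩
  have hne : (y : V) ≠ z := fun h => hyz (by rw [Subtype.ext h])
  have hadj : ¬ G.Adj y z := fun h => hyz (SimpleGraph.Adj.reachable (by simpa using h))
  obtain ⟨w, hw, hwx⟩ := Set.exists_ne_of_one_lt_ncard (h2 y z hne hadj) x
  rw [SimpleGraph.mem_commonNeighbors] at hw
  refine hyz (SimpleGraph.Reachable.trans (v := ⟨w, hwx⟩) ?_ ?_)
  · exact SimpleGraph.Adj.reachable (by simpa using hw.1)
  · exact SimpleGraph.Adj.reachable (by simpa using hw.2.symm)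

/-- If all labels agree outside `a`, `b`, two vertices differing at both are joined through the two
corners they span. -/
theorem IsHammingLabelling.exists_corners {Γ : G.edgeSet → ℕ} {f : V → ℕ → V}
    (hf : IsHammingLabelling Γ f)
    (h2 : ∀ u v : V, u ≠ v → ¬ G.Adj u v → 2 ≤ (G.commonNeighbors u v).ncard) {a b : ℕ}
    (hab : a ≠ b) (hcol : ∀ e, Γ e = a ∨ Γ e = b) (hext : ∀ u v, f u a = f v a → f u b = f v b → u = v)
    {u v : V} (ha : f u a ≠ f v a) (hb : f u b ≠ f v b) :
    ∃ w, f w a = f u a ∧ f w b = f v b ∧ G.Adj u w ∧ G.Adj w v := by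
  have hne : u ≠ v := fun h => ha (by rw [h])
  have hadj : ¬ G.Adj u v := fun h =>
    hab (((hf.2 u v h a).1 ha).trans ((hf.2 u v h b).1 hb).symm)
  have hw : ∀ w ∈ G.commonNeighbors u v,
      (f w a = f u a ∧ f w b = f v b) ∨ (f w a = f v a ∧ f w b = f u b) := by
    intro w hw
    rw [SimpleGraph.mem_commonNeighbors] at hw
    have h3 := hf.2 u w hw.1
    have h4 := hf.2 v w hw.2
    have h3a := h3 a
    have h3b := h3 b
    have h4a := h4 a
    have h4b := h4 b
    rcases hcol ⟨s(u, w), hw.1⟩ with h5 | h5 <;> rcases hcol ⟨s(v, w), hw.2⟩ with h6 | h6 <;>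
      rw [h5] at h3a h3b <;> rw [h6] at h4a h4b <;> clear h3 h4 h5 h6 hcol hext <;> grind
  obtain ⟨w₁, hw₁, w₂, hw₂, h12⟩ := (Set.one_lt_ncard_iff_nontrivial_and_finite.1 (h2 u v hne hadj)).1
  have hmain : ∀ w ∈ G.commonNeighbors u v, f w a = f u a → f w b = f v b →
      ∃ w, f w a = f u a ∧ f w b = f v b ∧ G.Adj u w ∧ G.Adj w v := by
    intro w hw h h'
    rw [SimpleGraph.mem_commonNeighbors] at hw
    exact ⟨w, h, h', hw.1, hw.2.symm⟩
  -- The two labels determine a vertex, so `w₁` and `w₂` cannot both be the opposite corner.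
  rcases hw w₁ hw₁ with h | h
  · exact hmain w₁ hw₁ h.1 h.2
  · rcases hw w₂ hw₂ with h' | h'
    · exact hmain w₂ hw₂ h'.1 h'.2
    · exact absurd (hext _ _ (h.1.trans h'.1.symm) (h.2.trans h'.2.symm)) h12

theorem exists_iso_boxProd_of_two_colors [Finite V] (hG : HasDistLeTwo G)
    (h2 : ∀ u v : V, u ≠ v → ¬ G.Adj u v → 2 ≤ (G.commonNeighbors u v).ncard)
    {Γ : G.edgeSet → ℕ} (hΓ : IsMDColoring Γ) (hk : (Set.range Γ).ncard = 2) :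
    ∃ s t : ℕ, 2 ≤ s ∧ 2 ≤ t ∧ Nonempty (G ≃g (SimpleGraph.completeGraph (Fin s)).boxProd
      (SimpleGraph.completeGraph (Fin t))) := by
  obtain ⟨f, hf⟩ := hΓ.exists_labelling
  obtain ⟨a, b, hab, hr⟩ := Set.ncard_eq_two.1 hk
  have hcol : ∀ e, Γ e = a ∨ Γ e = b := fun e => by
    have : Γ e ∈ Set.range Γ := ⟨e, rfl⟩
    simpa [hr] using this
  have hedge : ∀ c ∈ Set.range Γ, ∃ u v, f u c ≠ f v c := by
    rintro _ ⟨⟨⟨u, v⟩, huv⟩, rfl⟩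
    exact ⟨u, v, hf.ne_color huv⟩
  obtain ⟨p, q, hpq⟩ := hedge a (by simp [hr])
  obtain ⟨p', q', hpq'⟩ := hedge b (by simp [hr])
  have hext : ∀ u v, f u a = f v a → f u b = f v b → u = v := by
    intro u v ha hb
    refine hf.1 (funext fun d => ?_)
    by_cases hda : d = a
    · rw [hda, ha]
    by_cases hdb : d = b
    · rw [hdb, hb]
    refine reachable_induction (P := fun w => f u d = f w d) (hG.preconnected u v) rfl ?_
    intro x y hxy h
    rw [h]
    refine hf.eq_of_ne_color hxy ?_
    rcases hcol ⟨s(x, y), hxy⟩ with h | h <;> rw [h] <;> assumption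
  have hcorner := fun u v => hf.exists_corners h2 hab hcol hext (u := u) (v := v)
  have hsurj : ∀ u v, ∃ w, f w a = f u a ∧ f w b = f v b := by
    intro u v
    by_cases ha : f u a = f v a
    · exact ⟨v, ha.symm, rfl⟩
    by_cases hb : f u b = f v b
    · exact ⟨u, rfl, hb⟩
    obtain ⟨w, h, h', -⟩ := hcorner u v ha hb
    exact ⟨w, h, h'⟩
  have hadj_row : ∀ u v, f u a = f v a → f u b ≠ f v b → G.Adj u v := by
    intro u v ha hb
    -- Leave the row of `u` and `v` to a vertex `w` with the `b`-label of `v`: the corner of `u` and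
    -- `w` in that row is `v`, hence adjacent to `u`.
    obtain ⟨r, hr⟩ : ∃ r, f u a ≠ f r a := by
      by_contra! h
      exact hpq ((h p).symm.trans (h q))
    obtain ⟨w, hwa, hwb⟩ := hsurj r v
    obtain ⟨t, h1, h3, h4, -⟩ := hcorner u w (hwa ▸ hr) (hwb ▸ hb)
    rwa [hext t v (h1.trans ha) (h3.trans hwb)] at h4
  have hadj_col : ∀ u v, f u a ≠ f v a → f u b = f v b → G.Adj u v := by
    intro u v ha hb
    obtain ⟨r, hr⟩ : ∃ r, f u b ≠ f r b := by
      by_contra! h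
      exact hpq' ((h p').symm.trans (h q'))
    obtain ⟨w, hwa, hwb⟩ := hsurj v r
    obtain ⟨t, h1, h3, -, h4⟩ := hcorner w u (hwa ▸ ha.symm) (hwb ▸ hr.symm)
    rw [hext t v (h1.trans hwa) (h3.trans hb)] at h4
    exact h4.symm
  have hadj : ∀ u v, G.Adj u v ↔ (f u a ≠ f v a ∧ f u b = f v b) ∨ (f u b ≠ f v b ∧ f u a = f v a) := by
    intro u v
    constructor
    · intro h
      have h3a := hf.2 u v h a
      have h3b := hf.2 u v h b
      rcases hcol ⟨s(u, v), h⟩ with h5 | h5 <;> rw [h5] at h3a h3b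
      · exact Or.inl ⟨h3a.2 rfl, not_not.1 fun h => hab (h3b.1 h).symm⟩
      · exact Or.inr ⟨h3b.2 rfl, not_not.1 fun h => hab (h3a.1 h)⟩
    · rintro (h | h)
      · exact hadj_col u v h.1 h.2
      · exact hadj_row u v h.2 h.1
  obtain ⟨s, ⟨eA⟩⟩ := Finite.exists_equiv_fin (Set.range fun v => f v a)
  obtain ⟨t, ⟨eB⟩⟩ := Finite.exists_equiv_fin (Set.range fun v => f v b)
  let A : V → Fin s := fun v => eA ⟨f v a, v, rfl⟩
  let B : V → Fin t := fun v => eB ⟨f v b, v, rfl⟩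
  have hA : ∀ u v, A u = A v ↔ f u a = f v a := fun u v =>
    eA.apply_eq_iff_eq.trans Subtype.mk_eq_mk
  have hB : ∀ u v, B u = B v ↔ f u b = f v b := fun u v =>
    eB.apply_eq_iff_eq.trans Subtype.mk_eq_mk
  have hAs : ∀ i, ∃ v, A v = i := by
    intro i
    obtain ⟨v, hv⟩ := (eA.symm i).2
    exact ⟨v, eA.symm.injective (Subtype.ext (by simpa [A] using hv))⟩
  have hBs : ∀ i, ∃ v, B v = i := by
    intro i
    obtain ⟨v, hv⟩ := (eB.symm i).2
    exact ⟨v, eB.symm.injective (Subtype.ext (by simpa [B] using hv))⟩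
  have hbij : Function.Bijective fun v => (A v, B v) := by
    constructor
    · intro u v h
      rw [Prod.mk.injEq, hA, hB] at h
      exact hext u v h.1 h.2
    · rintro ⟨i, j⟩
      obtain ⟨u, rfl⟩ := hAs i
      obtain ⟨v, rfl⟩ := hBs j
      obtain ⟨w, h, h'⟩ := hsurj u v
      exact ⟨w, Prod.ext ((hA _ _).2 h) ((hB _ _).2 h')⟩
  have htwo : ∀ {n : ℕ} (i j : Fin n), i ≠ j → 2 ≤ n := by
    intro n i j h
    have := Fin.val_ne_of_ne h
    omega
  refine ⟨s, t, htwo (A p) (A q) (mt (hA _ _).1 hpq), htwo (B p') (B q') (mt (hB _ _).1 hpq'),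
    ⟨Equiv.ofBijective _ hbij, ?_⟩⟩
  intro u v
  simp [SimpleGraph.boxProd_adj, SimpleGraph.completeGraph, hadj, hA, hB]

theorem exists_two_coloring_of_iso_boxProd {α β : Type*} [Nontrivial α] [Nontrivial β]
    (φ : G ≃g (SimpleGraph.completeGraph α).boxProd (SimpleGraph.completeGraph β)) :
    ∃ Γ : G.edgeSet → ℕ, IsMDColoring Γ ∧ (Set.range Γ).ncard = 2 := by
  classical
  have hadj : ∀ u v, G.Adj u v ↔ ((φ u).1 ≠ (φ v).1 ∧ (φ u).2 = (φ v).2) ∨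
      ((φ u).2 ≠ (φ v).2 ∧ (φ u).1 = (φ v).1) := by
    intro u v
    rw [← φ.map_adj_iff, SimpleGraph.boxProd_adj]
    simp [SimpleGraph.completeGraph]
  -- `P` marks the edges that change the second coordinate. Deleting all edges of one direction
  -- freezes the coordinate they change.
  let P : Sym2 V → Prop := fun e => ∀ u ∈ e, ∀ v ∈ e, (φ u).1 = (φ v).1
  have hP : ∀ u v, P s(u, v) ↔ (φ u).1 = (φ v).1 := by
    intro u v
    constructor
    · exact fun h => h u (Sym2.mem_mk_left _ _) v (Sym2.mem_mk_right _ _)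
    · intro h x hx y hy
      rw [Sym2.mem_iff] at hx hy
      rcases hx with rfl | rfl <;> rcases hy with rfl | rfl <;> simp [h]
  refine ⟨fun e => if P e then 1 else 0, ?_, ?_⟩
  · intro u v huv
    by_cases h1 : (φ u).1 = (φ v).1
    · have h2 : (φ u).2 ≠ (φ v).2 := fun h => huv (φ.injective (Prod.ext h1 h))
      refine ⟨{e | e ∈ G.edgeSet ∧ P e}, ⟨fun e he => he.1, fun hr => h2 ?_⟩, 1, fun e he => ?_⟩
      · refine reachable_induction (P := fun w => (φ u).2 = (φ w).2) hr rfl ?_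
        intro x y hxy h
        rw [SimpleGraph.deleteEdges_adj] at hxy
        rcases (hadj x y).1 hxy.1 with h' | h'
        · exact h.trans h'.2
        · exact absurd ⟨hxy.1, (hP x y).2 h'.2⟩ hxy.2
      · exact if_pos he.2
    · refine ⟨{e | e ∈ G.edgeSet ∧ ¬ P e}, ⟨fun e he => he.1, fun hr => h1 ?_⟩, 0, fun e he => ?_⟩
      · refine reachable_induction (P := fun w => (φ u).1 = (φ w).1) hr rfl ?_
        intro x y hxy h
        rw [SimpleGraph.deleteEdges_adj] at hxy
        rcases (hadj x y).1 hxy.1 with h' | h'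
        · exact absurd ⟨hxy.1, fun h => h'.1 ((hP x y).1 h)⟩ hxy.2
        · exact h.trans h'.2
      · exact if_neg he.2
  · obtain ⟨a, a', ha⟩ := exists_pair_ne α
    obtain ⟨b, b', hb⟩ := exists_pair_ne β
    refine Set.ncard_eq_two.2 ⟨1, 0, one_ne_zero, Set.Subset.antisymm ?_ ?_⟩
    · rintro _ ⟨e, rfl⟩
      dsimp only
      split_ifs <;> simp
    · rintro _ (rfl | rfl)
      · refine ⟨⟨s(φ.symm (a, b), φ.symm (a, b')), (hadj _ _).2 (by simp [hb])⟩, if_pos ?_⟩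
        simp [hP]
      · refine ⟨⟨s(φ.symm (a, b), φ.symm (a', b)), (hadj _ _).2 (by simp [ha])⟩, if_neg ?_⟩
        simp [hP, ha]

end MonoDisc

theorem mainTheorem2 {V : Type*} [Finite V] (G : SimpleGraph V) (hdiam : G.diam = 2) :
    ((∃ v : V, MonoDisc.IsCutVertex G v) → MonoDisc.md G = MonoDisc.numBlocks G) ∧
    (MonoDisc.IsTwoConnected G → MonoDisc.md G ≤ 2) ∧
    ((∀ u v : V, u ≠ v → ¬ G.Adj u v → 2 ≤ (G.commonNeighbors u v).ncard) →
      MonoDisc.md G ≤ 2 ∧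
      (MonoDisc.md G = 2 ↔
        ∃ s t : ℕ, 2 ≤ s ∧ 2 ≤ t ∧
          Nonempty (G ≃g (SimpleGraph.completeGraph (Fin s)).boxProd (SimpleGraph.completeGraph (Fin t))))) := by
  have hG := MonoDisc.hasDistLeTwo_of_diam_eq_two hdiam
  refine ⟨fun ⟨v, hv⟩ => MonoDisc.md_eq_numBlocks hG hv,
    fun h => MonoDisc.md_le_two_of_no_cutVertex hG h.2.2, fun h2 => ?_⟩
  have hle := MonoDisc.md_le_two_of_no_cutVertex hG
    (MonoDisc.not_isCutVertex_of_two_commonNeighbors h2)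
  refine ⟨hle, fun h => ?_, ?_⟩
  · obtain ⟨Γ, hΓ, hk⟩ := (MonoDisc.isGreatest_md G).1
    exact MonoDisc.exists_iso_boxProd_of_two_colors hG h2 hΓ (hk.trans h)
  · rintro ⟨s, t, hs, ht, ⟨φ⟩⟩
    have : Nontrivial (Fin s) := Fin.nontrivial_iff_two_le.2 hs
    have : Nontrivial (Fin t) := Fin.nontrivial_iff_two_le.2 ht
    exact hle.antisymm ((MonoDisc.isGreatest_md G).2
      (MonoDisc.exists_two_coloring_of_iso_boxProd φ))
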